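/- For $\mu>0$ let $\eta:\mathbf R\to\mathbf R$ be a function such that (i) $\eta\ge 0$, $\eta$ is even and convex; (ii) $\eta^{-1}(0)=[-\mu,\mu]$; (iii) there is $a>0$ with $\eta(x)>1$ whenever $|x|>a$; (iv) $\eta'(x)$ exists and is nonzero whenever $\eta(x)=1$. The worm with parameter $\mu$ is $$\mathcal W_\mu=\bigl\{(z_1,z_2)\in\mathbf C^2:\ z_2\ne0,\ \bigl|z_1-e^{i\log|z_2|^2}\bigr|^2<1-\eta(\log|z_2|^2)\bigr\}.$$ A defining function for a domain $\Omega\subset\mathbf C^2$ is a real function $\tilde\varrho$ that is $C^\infty$ on an open neighbourhood $U$ of $\overline\Omega$, with $\Omega=\{z\in U:\tilde\varrho(z)<0\}$ and $d\tilde\varrho\neq0$ at every point of $\partial\Omega$. A bounded plurisubharmonic exhaustion function for $\Omega$ is a function $\lambda$ that is continuous on $\overline\Omega$, strictly plurisubharmonic on $\Omega$ (that is, $C^2$ with positive definite Levi form $\sum_{j,k}\frac{\partial^2\lambda}{\partial z_j\partial\bar z_k}v_j\bar v_k$), zero on $\partial\Omega$, negative on $\Omega$, and such that $\{z\in\Omega:\lambda(z)<c\}$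 is relatively compact in $\Omega$ for every $c<0$. **Theorem.** For every $\delta_0>0$ there exists $\mu_0>0$ such that for all $\mu\ge\mu_0$ and every worm $\mathcal W_\mu$ with parameter $\mu$ (that is, every $\eta$ as above) the following holds: if $\tilde\varrho$ is a defining function for $\mathcal W_\mu$ and $\delta>0$ is such that $-(-\tilde\varrho)^\delta$ is a bounded plurisubharmonic exhaustion function for $\mathcal W_\mu$, then $\delta<\delta_0$. More precisely, for every $\mu>0$, every worm $\mathcal W_\mu$ with parameter $\mu$, every defining function $\tilde\varrho$ for $\mathcal W_\mu$ and every $\delta>0$ such that $-(-\tilde\varrho)^\delta$ is a bounded plurisubharmonic exhaustion function for $\mathcal W_\mu$, one has $\delta<\nu=\pi/(2\mu)$. -/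

import Mathlib

open Set
open scoped ContDiff

/-- The conditions (i)-(iv) on the function `η` that enters the definition of the worm with
parameter `μ`. (Where `η x = 1`, a nonzero `deriv` includes differentiability at `x`.) -/
structure IsWormProfile (μ : ℝ) (η : ℝ → ℝ) : Prop where
  nonneg : ∀ x, 0 ≤ η x
  even : Function.Even η
  convex : ConvexOn ℝ univ η
  zero_set : η ⁻¹' {0} = Icc (-μ) μ
  large : ∃ a : ℝ, 0 < a ∧ ∀ x, a < |x| → 1 < η x
  deriv_ne : ∀ x, η x = 1 → deriv η x ≠ 0

/-- The worm `{(z₁, z₂) : |z₁ - exp (i log |z₂|²)|² < 1 - η (log |z₂|²)}` in `ℂ²`.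
The points with `z₂ = 0`, where `log |z₂|²` is undefined, are excluded explicitly. -/
def worm (η : ℝ → ℝ) : Set (ℂ × ℂ) :=
  {z | z.2 ≠ 0 ∧
    ‖z.1 - Complex.exp (Complex.I * (Real.log (‖z.2‖ ^ 2) : ℝ))‖ ^ 2
      < 1 - η (Real.log (‖z.2‖ ^ 2))}

/-- `r` is a (smooth) defining function of `Ω`: it is `C^∞` on an open neighbourhood `U` of the
closure of `Ω`, `Ω` is the part of `U` where `r < 0`, and the differential of `r` vanishes
nowhere on the boundary. (It follows that `r = 0` on the boundary.) -/
def IsDefiningFunction (r : ℂ × ℂ → ℝ) (Ω : Set (ℂ × ℂ)) : Prop :=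
  ∃ U : Set (ℂ × ℂ), IsOpen U ∧ closure Ω ⊆ U ∧ ContDiffOn ℝ ∞ r U ∧
    Ω = {z | z ∈ U ∧ r z < 0} ∧ ∀ p ∈ frontier Ω, fderiv ℝ r p ≠ 0

/-- The Levi form (complex Hessian) `∑ⱼₖ ∂²u/∂zⱼ∂z̄ₖ (p) vⱼ v̄ₖ`, written through the real second
derivative as `(D²u(p)(v, v) + D²u(p)(iv, iv)) / 4`. -/
noncomputable def leviForm (u : ℂ × ℂ → ℝ) (p v : ℂ × ℂ) : ℝ :=
  (iteratedFDeriv ℝ 2 u p ![v, v]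
    + iteratedFDeriv ℝ 2 u p ![Complex.I • v, Complex.I • v]) / 4

/-- Strict plurisubharmonicity on an open set: `u` is of class `C²` with positive definite
Levi form. -/
def StrictlyPlurisubharmonicOn (u : ℂ × ℂ → ℝ) (Ω : Set (ℂ × ℂ)) : Prop :=
  ContDiffOn ℝ 2 u Ω ∧ ∀ p ∈ Ω, ∀ v : ℂ × ℂ, v ≠ 0 → 0 < leviForm u p v

/-- Bounded plurisubharmonic exhaustion functions `u` of a domain `Ω` in `ℂ²`. -/
structure IsBoundedPshExhaustion (u : ℂ × ℂ → ℝ) (Ω : Set (ℂ × ℂ)) : Prop where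
  continuousOn : ContinuousOn u (closure Ω)
  strictlyPsh : StrictlyPlurisubharmonicOn u Ω
  boundary : ∀ z ∈ frontier Ω, u z = 0
  neg : ∀ z ∈ Ω, u z < 0
  exhaustion : ∀ c : ℝ, c < 0 →
    IsCompact (closure {z | z ∈ Ω ∧ u z < c}) ∧ closure {z | z ∈ Ω ∧ u z < c} ⊆ Ω

open Filter Topology Metric Module
open scoped InnerProductSpace Laplacian
open Complex (I)

/-!
The holomorphic curves `w ↦ (ε e^{2iw}, e^w)` lie in the worm for `|2 Re w| < μ` and small `ε > 0`,
and they approach the boundary annulus `{0} × {e^w}`. Since `e^{2iw}` is `e^{-2 Im w}` times the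
unit vector `e^{2i Re w}` pointing to the centre of the disc over `e^w`, a first order expansion of
`r` along these curves shows that, after rescaling, the pullbacks of the superharmonic function
`(-r)^δ` converge locally uniformly on the strip to `e^{-2δ Im w} h(w)`, where `h` is the `δ`-th
power of the slope of `-r` in that direction: it is positive up to the edges of the strip and
`2πi`-periodic. If `π / μ ≤ 2δ`, some multiple of `e^{-2δ Im w} cos (q Re w)` with `q < π / μ`
touches this limit from below inside the strip, because `cos (q Re w)` is almost zero on the edges.
That multiple has Laplacian of the sign of `(2δ)² - q² > 0`, whereas a limit of superharmonic
functions cannot be touched from below by a strictly subharmonic function.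
-/

section SecondDerivative

variable {𝕜 E F G : Type*} [NontriviallyNormedField 𝕜] [NormedAddCommGroup E] [NormedSpace 𝕜 E]
  [NormedAddCommGroup F] [NormedSpace 𝕜 F] [NormedAddCommGroup G] [NormedSpace 𝕜 G]

theorem iteratedFDeriv_two_comp {u : F → G} {γ : E → F} {x : E}
    (hu : ContDiffAt 𝕜 2 u (γ x)) (hγ : ContDiffAt 𝕜 2 γ x) (v w : E) :
    iteratedFDeriv 𝕜 2 (u ∘ γ) x ![v, w] =
      iteratedFDeriv 𝕜 2 u (γ x) ![fderiv 𝕜 γ x v, fderiv 𝕜 γ x w] +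
        fderiv 𝕜 u (γ x) (iteratedFDeriv 𝕜 2 γ x ![v, w]) := by
  have hchain : fderiv 𝕜 (u ∘ γ) =ᶠ[𝓝 x] fun y => (fderiv 𝕜 u (γ y)).comp (fderiv 𝕜 γ y) := by
    filter_upwards [hγ.continuousAt.eventually (hu.eventually (by simp)), hγ.eventually (by simp)]
      with y huy hγy
    exact fderiv_comp y (huy.differentiableAt (by simp)) (hγy.differentiableAt (by simp))
  have hu' : DifferentiableAt 𝕜 (fderiv 𝕜 u) (γ x) :=
    (hu.fderiv_right (m := 1) (by norm_num)).differentiableAt (by simp)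
  have hγ' : DifferentiableAt 𝕜 (fderiv 𝕜 γ) x :=
    (hγ.fderiv_right (m := 1) (by norm_num)).differentiableAt (by simp)
  have hγ₁ : DifferentiableAt 𝕜 γ x := hγ.differentiableAt (by simp)
  simp only [iteratedFDeriv_two_apply, hchain.fderiv_eq]
  have hcomp : HasFDerivAt (fun y => fderiv 𝕜 u (γ y)) _ x :=
    hu'.hasFDerivAt.comp x hγ₁.hasFDerivAt
  rw [(hcomp.clm_comp hγ'.hasFDerivAt).fderiv]
  simp [add_comm]

end SecondDerivative

section Laplacian

variable {E : Type*} [NormedAddCommGroup E]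

theorem iteratedFDeriv_two_eq_deriv_deriv_line [NormedSpace ℝ E] {f : E → ℝ} {x : E}
    (hf : ContDiffAt ℝ 2 f x) (v : E) :
    iteratedFDeriv ℝ 2 f x ![v, v] = deriv (deriv fun t : ℝ => f (x + t • v)) 0 := by
  have hline : fderiv ℝ (fun t : ℝ => x + t • v) = fun _ => .toSpanSingleton ℝ v :=
    funext fun t => HasFDerivAt.fderiv <| by
      simpa using! ((hasFDerivAt_id t).smul_const v).const_add x
  have hcomp := iteratedFDeriv_two_comp (γ := fun t : ℝ => x + t • v) (x := 0)
    (by simpa using hf) (by fun_prop) 1 1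
  have hline₂ : iteratedFDeriv ℝ 2 (fun t : ℝ => x + t • v) 0 ![1, 1] = 0 := by
    simp [iteratedFDeriv_two_apply, hline]
  calc iteratedFDeriv ℝ 2 f x ![v, v]
      = iteratedFDeriv ℝ 2 (fun t : ℝ => f (x + t • v)) 0 ![1, 1] := by
        rw [hline₂, map_zero, add_zero, hline] at hcomp
        simpa [Function.comp_def] using hcomp.symm
    _ = iteratedDeriv 2 (fun t : ℝ => f (x + t • v)) 0 := by
        rw [iteratedDeriv_eq_iteratedFDeriv]
        congr 1
        ext i
        fin_cases i <;> rfl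
    _ = deriv (deriv fun t : ℝ => f (x + t • v)) 0 := by
        rw [iteratedDeriv_succ, iteratedDeriv_one]

theorem iteratedFDeriv_two_nonneg_of_isLocalMin [NormedSpace ℝ E] {f : E → ℝ} {x : E}
    (hmin : IsLocalMin f x) (hf : ContDiffAt ℝ 2 f x) (v : E) :
    0 ≤ iteratedFDeriv ℝ 2 f x ![v, v] := by
  rw [iteratedFDeriv_two_eq_deriv_deriv_line hf]
  set g : ℝ → ℝ := fun t => f (x + t • v)
  have hline : Tendsto (fun t : ℝ => x + t • v) (𝓝 0) (𝓝 x) := by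
    simpa using (by fun_prop : Continuous fun t : ℝ => x + t • v).tendsto 0
  have hgmin : IsLocalMin g 0 := by
    filter_upwards [hline.eventually hmin] with t ht
    simpa [g] using ht
  have hgcont : ContinuousAt g 0 := by
    simpa [g, ContinuousAt, Function.comp_def] using hf.continuousAt.tendsto.comp hline
  by_contra! hneg
  have hgmax : IsLocalMax g 0 := isLocalMax_of_deriv_deriv_neg hneg hgmin.deriv_eq_zero hgcont
  have hconst : g =ᶠ[𝓝 0] fun _ => g 0 := by
    filter_upwards [hgmin, hgmax] with t hle hge using le_antisymm hge hle
  simp [hconst.deriv.deriv_eq] at hneg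

variable [InnerProductSpace ℝ E] [FiniteDimensional ℝ E]

theorem laplacian_nonneg_of_isLocalMin {f : E → ℝ} {x : E} (hmin : IsLocalMin f x)
    (hf : ContDiffAt ℝ 2 f x) : 0 ≤ Δ f x := by
  rw [InnerProductSpace.laplacian_eq_iteratedFDeriv_stdOrthonormalBasis]
  exact Finset.sum_nonneg fun i _ => iteratedFDeriv_two_nonneg_of_isLocalMin hmin hf _

theorem continuousAt_laplacian {f : E → ℝ} {x : E} (hf : ContDiffAt ℝ 2 f x) :
    ContinuousAt (Δ f) x := by
  have hsecond : ContinuousAt (iteratedFDeriv ℝ 2 f) x := hf.continuousAt_iteratedFDeriv le_rfl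
  rw [InnerProductSpace.laplacian_eq_iteratedFDeriv_stdOrthonormalBasis]
  exact tendsto_finsetSum _ fun i _ => hsecond.eval_const _

theorem laplacian_norm_sub_sq (c x : E) : Δ (fun y => ‖y - c‖ ^ 2) x = 2 * finrank ℝ E := by
  have hsq : ContDiff ℝ 2 fun y : E => ‖y - c‖ ^ 2 := (contDiff_id.sub contDiff_const).norm_sq ℝ
  have hline (v : E) : (fun t : ℝ => ‖x + t • v - c‖ ^ 2) =
      fun t => ‖x - c‖ ^ 2 + 2 * ⟪x - c, v⟫_ℝ * t + ‖v‖ ^ 2 * t ^ 2 := by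
    ext t
    rw [add_sub_right_comm, norm_add_sq_real, inner_smul_right, norm_smul, mul_pow,
      Real.norm_eq_abs, sq_abs]
    ring
  have hsecond (v : E) : iteratedFDeriv ℝ 2 (fun y => ‖y - c‖ ^ 2) x ![v, v] = 2 * ‖v‖ ^ 2 := by
    rw [iteratedFDeriv_two_eq_deriv_deriv_line hsq.contDiffAt, hline]
    have hderiv : deriv (fun t => ‖x - c‖ ^ 2 + 2 * ⟪x - c, v⟫_ℝ * t + ‖v‖ ^ 2 * t ^ 2) =
        fun t => 2 * ⟪x - c, v⟫_ℝ + 2 * ‖v‖ ^ 2 * t := by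
      ext t
      have h := (((hasDerivAt_id t).const_mul (2 * ⟪x - c, v⟫_ℝ)).const_add (‖x - c‖ ^ 2)).add
        ((hasDerivAt_pow 2 t).const_mul (‖v‖ ^ 2))
      refine h.deriv.trans ?_
      norm_num
      ring
    simp [hderiv]
  simp [InnerProductSpace.laplacian_eq_iteratedFDeriv_stdOrthonormalBasis, hsecond, mul_comm]

end Laplacian

section Viscosity

variable {E ι : Type*} [NormedAddCommGroup E] [InnerProductSpace ℝ E] [FiniteDimensional ℝ E]

theorem exists_neg_le_laplacian_of_sphere_lt {g : E → ℝ} {x : E} {ρ κ : ℝ} (hρ : 0 ≤ ρ)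
    (hg : ∀ y ∈ closedBall x ρ, ContDiffAt ℝ 2 g y)
    (hsphere : ∀ y ∈ sphere x ρ, g x < g y + κ * ρ ^ 2) :
    ∃ y ∈ ball x ρ, -(2 * finrank ℝ E * κ) ≤ Δ g y := by
  have hsq : ContDiff ℝ 2 fun y : E => ‖y - x‖ ^ 2 := (contDiff_id.sub contDiff_const).norm_sq ℝ
  -- The quadratic term pushes the minimum of `ψ` off the sphere.
  set ψ : E → ℝ := g + κ • fun y => ‖y - x‖ ^ 2 with hψ_def
  have hψ : ∀ y ∈ closedBall x ρ, ContDiffAt ℝ 2 ψ y := fun y hy =>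
    (hg y hy).add (hsq.contDiffAt.const_smul κ)
  have hψ_sphere : ∀ y ∈ sphere x ρ, ψ x < ψ y := by
    intro y hy
    simpa [ψ, mem_sphere_iff_norm.1 hy] using hsphere y hy
  obtain ⟨y, hy, hmin⟩ := exists_isLocalMin_mem_ball
    (fun y hy => (hψ y hy).continuousAt.continuousWithinAt) (mem_closedBall_self hρ) hψ_sphere
  have hy' := ball_subset_closedBall hy
  have hΔ : Δ ψ y = Δ g y + κ * (2 * finrank ℝ E) := by
    rw [hψ_def, (hg y hy').laplacian_add (f₂ := κ • fun y => ‖y - x‖ ^ 2)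
      (hsq.contDiffAt.const_smul κ), InnerProductSpace.laplacian_smul κ hsq.contDiffAt,
      laplacian_norm_sub_sq, smul_eq_mul]
  exact ⟨y, hy, by linarith [laplacian_nonneg_of_isLocalMin hmin (hψ y hy')]⟩

theorem not_isLocalMin_sub_of_laplacian_nonpos {l : Filter ι} [l.NeBot] {f : ι → E → ℝ}
    {F φ : E → ℝ} {U : Set E} {x : E} (hU : IsOpen U) (hx : x ∈ U)
    (hfF : TendstoLocallyUniformlyOn f F l U)
    (hf : ∀ᶠ p : ι × E in l ×ˢ 𝓝 x, ContDiffAt ℝ 2 (f p.1) p.2 ∧ Δ (f p.1) p.2 ≤ 0)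
    (hφ : ContDiffAt ℝ 2 φ x) (hpos : 0 < Δ φ x) : ¬ IsLocalMin (F - φ) x := by
  intro hmin
  obtain ⟨κ, hκ, hκφ⟩ : ∃ κ : ℝ, 0 < κ ∧ 2 * finrank ℝ E * κ < Δ φ x :=
    ⟨Δ φ x / (2 * finrank ℝ E + 1), by positivity, by
      rw [mul_div_assoc', div_lt_iff₀ (by positivity)]
      nlinarith⟩
  obtain ⟨good, hgood, near, hnear, hgn⟩ := eventually_prod_iff.1 hf
  obtain ⟨ρ, hρ, hball⟩ := nhds_basis_closedBall.mem_iff.1 <|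
    inter_mem (hU.mem_nhds hx) <| hnear.and <| hmin.and <| (hφ.eventually (by simp)).and <|
      (continuousAt_laplacian hφ).eventually (lt_mem_nhds hκφ)
  have hunif : TendstoUniformlyOn f F l (closedBall x ρ) :=
    (tendstoLocallyUniformlyOn_iff_forall_isCompact hU).1 hfF _ (fun y hy => (hball hy).1)
      (isCompact_closedBall x ρ)
  obtain ⟨i, hi, hclose⟩ := (hgood.and
    (Metric.tendstoUniformlyOn_iff.1 hunif (κ * ρ ^ 2 / 2) (by positivity))).exists
  have hfi : ∀ y ∈ closedBall x ρ, ContDiffAt ℝ 2 (f i) y ∧ Δ (f i) y ≤ 0 := fun y hy =>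
    hgn hi (hball hy).2.1
  have hφ' : ∀ y ∈ closedBall x ρ, ContDiffAt ℝ 2 φ y ∧ 2 * finrank ℝ E * κ < Δ φ y :=
    fun y hy => (hball hy).2.2.2
  obtain ⟨y, hy, hΔ⟩ := exists_neg_le_laplacian_of_sphere_lt (g := f i - φ) (κ := κ) hρ.le
    (fun y hy => (hfi y hy).1.sub (hφ' y hy).1) fun y hy => by
      have hle : F x - φ x ≤ F y - φ y := (hball (sphere_subset_closedBall hy)).2.2.1
      have hx' := abs_lt.1 (Real.dist_eq _ _ ▸ hclose x (mem_closedBall_self hρ.le))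
      have hy' := abs_lt.1 (Real.dist_eq _ _ ▸ hclose y (sphere_subset_closedBall hy))
      simp only [Pi.sub_apply]
      linarith [hx'.1, hx'.2, hy'.1, hy'.2]
  have hy' := ball_subset_closedBall hy
  rw [(hfi y hy').1.laplacian_sub (hφ' y hy').1] at hΔ
  linarith [(hfi y hy').2, (hφ' y hy').2]

end Viscosity

theorem tendsto_inv_smul_sub_of_hasStrictFDerivAt {α 𝕜 E F : Type*} [NontriviallyNormedField 𝕜]
    [NormedAddCommGroup E] [NormedSpace 𝕜 E] [NormedAddCommGroup F] [NormedSpace 𝕜 F]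
    {f : E → F} {f' : E →L[𝕜] F} {x v : E} {l : Filter α} {a b : α → E} {ε : α → 𝕜}
    (hf : HasStrictFDerivAt f f' x) (ha : Tendsto a l (𝓝 x)) (hb : Tendsto b l (𝓝 v))
    (hε : Tendsto ε l (𝓝[≠] 0)) :
    Tendsto (fun i => (ε i)⁻¹ • (f (a i + ε i • b i) - f (a i))) l (𝓝 (f' v)) := by
  obtain ⟨hε₀, hε_ne⟩ := tendsto_nhdsWithin_iff.1 hε
  have hpair : Tendsto (fun i => (a i + ε i • b i, a i)) l (𝓝 (x, x)) := by
    simpa using (ha.add (hε₀.smul hb)).prodMk_nhds ha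
  have hremainder : (fun i => f (a i + ε i • b i) - f (a i) - f' (ε i • b i)) =o[l] ε := by
    have hbigO : (fun i => ε i • b i) =O[l] ε := by
      simpa using (Asymptotics.isBigO_refl ε l).smul (hb.isBigO_one 𝕜)
    simpa [Function.comp_def] using
      (hf.isLittleO.comp_tendsto hpair).trans_isBigO (by simpa [Function.comp_def] using hbigO)
  have hzero : Tendsto (fun i => (ε i)⁻¹ • (f (a i + ε i • b i) - f (a i) - f' (ε i • b i))) l
      (𝓝 0) := hremainder.tendsto_inv_smul_nhds_zero
  have hlim := hzero.add ((f'.continuous.tendsto v).comp hb)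
  rw [zero_add] at hlim
  refine hlim.congr' ?_
  filter_upwards [hε_ne] with i hi
  simp [smul_sub, smul_smul, inv_mul_cancel₀ hi]

theorem tendstoLocallyUniformlyOn_of_tendsto_prod {ι α β : Type*} [TopologicalSpace α]
    [UniformSpace β] {l : Filter ι} {f : ι → α → β} {F : α → β} {s : Set α}
    (hF : ContinuousOn F s)
    (hf : ∀ x ∈ s, Tendsto (fun p : ι × α => f p.1 p.2) (l ×ˢ 𝓝[s] x) (𝓝 (F x))) :
    TendstoLocallyUniformlyOn f F l s := by
  rw [tendstoLocallyUniformlyOn_iff_forall_tendsto]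
  intro x hx
  exact (((hF x hx).tendsto.comp tendsto_snd).prodMk_nhds (hf x hx)).mono_right
    (nhds_le_uniformity (F x))

section ComplexPlane

theorem laplacian_comp_eq_leviForm {u : ℂ × ℂ → ℝ} {γ : ℂ → ℂ × ℂ} {w : ℂ}
    (hu : ContDiffAt ℝ 2 u (γ w)) (hγ : ContDiffAt ℂ 2 γ w) :
    Δ (u ∘ γ) w = 4 * leviForm u (γ w) (deriv γ w) := by
  have hγ_real : ContDiffAt ℝ 2 γ w := hγ.restrict_scalars ℝ
  have hfderiv (v : ℂ) : fderiv ℝ γ w v = v • deriv γ w := by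
    have hderiv := (hγ.differentiableAt (by simp)).hasDerivAt.hasFDerivAt.restrictScalars ℝ
    simp [hderiv.fderiv]
  have hharm : iteratedFDeriv ℝ 2 γ w ![1, 1] + iteratedFDeriv ℝ 2 γ w ![I, I] = 0 := by
    simpa [InnerProductSpace.laplacian_eq_iteratedFDeriv_complexPlane] using
      hγ.harmonicAt.2.self_of_nhds
  rw [InnerProductSpace.laplacian_eq_iteratedFDeriv_complexPlane]
  calc iteratedFDeriv ℝ 2 (u ∘ γ) w ![1, 1] + iteratedFDeriv ℝ 2 (u ∘ γ) w ![I, I]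
      = 4 * leviForm u (γ w) (deriv γ w) + fderiv ℝ u (γ w)
          (iteratedFDeriv ℝ 2 γ w ![1, 1] + iteratedFDeriv ℝ 2 γ w ![I, I]) := by
        rw [iteratedFDeriv_two_comp hu hγ_real, iteratedFDeriv_two_comp hu hγ_real, leviForm,
          hfderiv, hfderiv, one_smul, map_add]
        ring
    _ = 4 * leviForm u (γ w) (deriv γ w) := by rw [hharm, map_zero, add_zero]

/-- The function `e^{p Im w} cos (q Re w)`, used as a comparison function on vertical strips: for
`|q| < |p|` it is strictly subharmonic where it is positive. -/
noncomputable def expCos (p q : ℝ) (w : ℂ) : ℝ :=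
  Real.exp (p * w.im) * Real.cos (q * w.re)

theorem contDiff_expCos (p q : ℝ) {n : WithTop ℕ∞} : ContDiff ℝ n (expCos p q) := by
  unfold expCos
  have hre : ContDiff ℝ n Complex.re := Complex.reCLM.contDiff
  have him : ContDiff ℝ n Complex.im := Complex.imCLM.contDiff
  fun_prop

theorem laplacian_expCos (p q : ℝ) (w : ℂ) :
    Δ (expCos p q) w = (p ^ 2 - q ^ 2) * expCos p q w := by
  have hC : ContDiffAt ℝ 2 (expCos p q) w := (contDiff_expCos p q).contDiffAt
  have haffine (c x t : ℝ) : HasDerivAt (fun t => c * (x + t)) c t := by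
    simpa using ((hasDerivAt_id t).const_add x).const_mul c
  have hone : deriv (deriv fun t : ℝ => expCos p q (w + t • 1)) 0 = -q ^ 2 * expCos p q w := by
    have hcos := fun t => ((haffine q w.re t).cos.const_mul (Real.exp (p * w.im))).deriv
    have hsin := fun t => ((haffine q w.re t).sin.neg.mul_const q).const_mul (Real.exp (p * w.im))
      |>.deriv
    simp only [expCos, Complex.add_re, Complex.add_im, Complex.real_smul, mul_one,
      Complex.ofReal_re, Complex.ofReal_im, add_zero, funext hcos]
    refine (hsin 0).trans ?_
    rw [add_zero]
    ring
  have hI : deriv (deriv fun t : ℝ => expCos p q (w + t • I)) 0 = p ^ 2 * expCos p q w := by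
    have hexp := fun t => ((haffine p w.im t).exp.mul_const (Real.cos (q * w.re))).deriv
    have hexp' := fun t => (((haffine p w.im t).exp.mul_const p).mul_const (Real.cos (q * w.re)))
      |>.deriv
    simp only [expCos, Complex.add_re, Complex.add_im, Complex.real_smul, Complex.re_ofReal_mul,
      Complex.im_ofReal_mul, Complex.I_re, Complex.I_im, mul_zero, mul_one, add_zero, funext hexp]
    refine (hexp' 0).trans ?_
    rw [add_zero]
    ring
  simp only [InnerProductSpace.laplacian_eq_iteratedFDeriv_complexPlane,
    iteratedFDeriv_two_eq_deriv_deriv_line hC, hone, hI]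
  ring

end ComplexPlane

section Strip

theorem isOpen_abs_re_lt (a : ℝ) : IsOpen {w : ℂ | |w.re| < a} :=
  isOpen_lt (by fun_prop) continuous_const

theorem exists_isMinOn_strip_of_periodic {β : Type*} [LinearOrder β] [TopologicalSpace β]
    [ClosedIicTopology β] {f : ℂ → β} {a T : ℝ} (ha : 0 ≤ a) (hT : 0 < T)
    (hf : ContinuousOn f {w | |w.re| ≤ a}) (hper : Function.Periodic f (T * I)) :
    ∃ w₀, |w₀.re| ≤ a ∧ ∀ w, |w.re| ≤ a → f w₀ ≤ f w := by
  have hsub : Icc (-a) a ×ℂ Icc 0 T ⊆ {w | |w.re| ≤ a} := fun w hw => abs_le.2 hw.1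
  obtain ⟨w₀, hw₀, hmin⟩ := (isCompact_Icc.reProdIm isCompact_Icc).exists_isMinOn
    ⟨0, by simp [Complex.mem_reProdIm, ha, hT.le]⟩ (hf.mono hsub)
  refine ⟨w₀, hsub hw₀, fun w hw => ?_⟩
  have hvert : Function.Periodic (fun y : ℝ => f (w.re + y * I)) T := fun y => by
    simpa [add_mul, add_assoc] using hper (w.re + y * I)
  obtain ⟨y, hy, hfy⟩ := hvert.exists_mem_Ico₀ hT w.im
  rw [Complex.re_add_im] at hfy
  exact hfy ▸ hmin (by simpa [Complex.mem_reProdIm, hy.1, hy.2.le] using abs_le.1 hw)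

theorem exists_cos_le_eq_of_periodic {h : ℂ → ℝ} {a T : ℝ} (ha : 0 < a) (hT : 0 < T)
    (hcont : ContinuousOn h {w | |w.re| ≤ a}) (hper : Function.Periodic h (T * I))
    (hpos : ∀ w, |w.re| ≤ a → 0 < h w) :
    ∃ q ∈ Ioo 0 (Real.pi / (2 * a)), ∃ c : ℝ, ∃ w₁, |w₁.re| < a ∧
      c * Real.cos (q * w₁.re) = h w₁ ∧ ∀ w, |w.re| ≤ a → c * Real.cos (q * w.re) ≤ h w := by
  obtain ⟨w₀, hw₀, hmin⟩ := exists_isMinOn_strip_of_periodic ha.le hT hcont hper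
  -- This choice of `q` makes `h w / cos (q Re w)` larger on the edges than at `0`, so that its
  -- minimum is attained inside the strip.
  obtain ⟨q, hqh, hq⟩ : ∃ q, Real.cos (q * a) * h 0 < h w₀ ∧ q ∈ Ioo 0 (Real.pi / (2 * a)) := by
    have hlim : Tendsto (fun q => Real.cos (q * a) * h 0) (𝓝[<] (Real.pi / (2 * a))) (𝓝 0) := by
      have hcts : Continuous fun q => Real.cos (q * a) * h 0 := by fun_prop
      have hzero : Real.cos (Real.pi / (2 * a) * a) * h 0 = 0 := by
        rw [show Real.pi / (2 * a) * a = Real.pi / 2 by field_simp, Real.cos_pi_div_two, zero_mul]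
      exact hzero ▸ (hcts.tendsto _).mono_left nhdsWithin_le_nhds
    exact ((hlim.eventually (gt_mem_nhds (hpos w₀ hw₀))).and
      (Ioo_mem_nhdsLT (by positivity))).exists
  have hqa : q * a < Real.pi / 2 := by
    have := (lt_div_iff₀ (by positivity)).1 hq.2
    linarith
  have hcos {w : ℂ} (hw : |w.re| ≤ a) : 0 < Real.cos (q * w.re) := by
    have hle : |q * w.re| ≤ q * a := by
      rw [abs_mul, abs_of_pos hq.1]
      exact mul_le_mul_of_nonneg_left hw hq.1.le
    exact Real.cos_pos_of_mem_Ioo ⟨by linarith [(abs_le.1 hle).1], by linarith [(abs_le.1 hle).2]⟩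
  obtain ⟨w₁, hw₁, hmin₁⟩ := exists_isMinOn_strip_of_periodic
    (f := fun w => h w / Real.cos (q * w.re)) ha.le hT
    (hcont.div (by fun_prop) fun w hw => (hcos hw).ne') fun w => by simp [hper w]
  refine ⟨q, hq, h w₁ / Real.cos (q * w₁.re), w₁, lt_of_le_of_ne hw₁ fun hedge => ?_,
    div_mul_cancel₀ _ (hcos hw₁).ne', fun w hw => (le_div_iff₀ (hcos hw)).1 (hmin₁ w hw)⟩
  have hcos_edge : Real.cos (q * w₁.re) = Real.cos (q * a) := by
    rw [← Real.cos_abs, abs_mul, abs_of_pos hq.1, hedge]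
  have hzero : h w₁ / Real.cos (q * w₁.re) ≤ h 0 := by simpa using hmin₁ 0 (by simpa using ha.le)
  rw [div_le_iff₀ (hcos hw₁), hcos_edge] at hzero
  linarith [hmin w₁ hw₁]

end Strip

section WormGeometry

/-- The centre `e^{2i Re w}` of the disc that the worm cuts out over `z₂ = e^w`. The coordinate `w`
on `z₂ ≠ 0` turns `log |z₂|²` into `2 Re w`. -/
noncomputable def wormCenter (w : ℂ) : ℂ := Complex.exp (I * (2 * w.re : ℝ))

theorem norm_wormCenter (w : ℂ) : ‖wormCenter w‖ = 1 := by
  rw [wormCenter, mul_comm, Complex.norm_exp_ofReal_mul_I]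

theorem wormCenter_add_ofReal_mul_I (w : ℂ) (y : ℝ) : wormCenter (w + y * I) = wormCenter w := by
  simp [wormCenter]

theorem continuous_wormCenter : Continuous wormCenter := by
  unfold wormCenter
  fun_prop

variable {η : ℝ → ℝ} {w : ℂ}

theorem mk_exp_mem_worm_iff (hη : η (2 * w.re) = 0) {v : ℂ} :
    (v, Complex.exp w) ∈ worm η ↔ v ∈ ball (wormCenter w) 1 := by
  have hlog : Real.log (‖Complex.exp w‖ ^ 2) = 2 * w.re := by
    rw [Complex.norm_exp, Real.log_pow, Real.log_exp]
    norm_num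
  simp only [worm, mem_ofPred_eq, hlog, hη, sub_zero, Complex.exp_ne_zero, ne_eq,
    not_false_eq_true, true_and, mem_ball_iff_norm, wormCenter, sq_lt_one_iff₀ (norm_nonneg _)]

theorem mk_exp_mem_closure_worm (hη : η (2 * w.re) = 0) {v : ℂ}
    (hv : v ∈ closedBall (wormCenter w) 1) : (v, Complex.exp w) ∈ closure (worm η) := by
  have hmaps : MapsTo (fun v => (v, Complex.exp w)) (ball (wormCenter w) 1) (worm η) :=
    fun v hv => (mk_exp_mem_worm_iff hη).2 hv
  exact hmaps.closure (by fun_prop) (by rwa [closure_ball _ one_ne_zero])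

theorem zero_mk_exp_mem_frontier_worm (hη : η (2 * w.re) = 0) :
    (0, Complex.exp w) ∈ frontier (worm η) := by
  have hdist : dist 0 (wormCenter w) = 1 := by simp [norm_wormCenter]
  refine ⟨mk_exp_mem_closure_worm hη hdist.le, fun hmem => ?_⟩
  exact ((mk_exp_mem_worm_iff hη).1 (interior_subset hmem)).ne hdist

end WormGeometry

section DefiningFunction

variable {r : ℂ × ℂ → ℝ} {Ω : Set (ℂ × ℂ)} {p : ℂ × ℂ}

theorem IsDefiningFunction.contDiffAt (hr : IsDefiningFunction r Ω) (hp : p ∈ closure Ω) :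
    ContDiffAt ℝ ∞ r p := by
  obtain ⟨U, hU, hΩU, hrU, -⟩ := hr
  exact hrU.contDiffAt (hU.mem_nhds (hΩU hp))

theorem IsDefiningFunction.neg_iff (hr : IsDefiningFunction r Ω) (hp : p ∈ closure Ω) :
    r p < 0 ↔ p ∈ Ω := by
  obtain ⟨U, -, hΩU, -, hΩ, -⟩ := hr
  rw [hΩ]
  exact ⟨fun h => ⟨hΩU hp, h⟩, fun h => h.2⟩

theorem IsDefiningFunction.isOpen (hr : IsDefiningFunction r Ω) : IsOpen Ω := by
  obtain ⟨U, hU, -, hrU, hΩ, -⟩ := hr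
  rw [hΩ]
  exact hrU.continuousOn.isOpen_inter_preimage hU isOpen_Iio

theorem IsDefiningFunction.nonpos (hr : IsDefiningFunction r Ω) (hp : p ∈ closure Ω) :
    r p ≤ 0 := by
  have hmaps : MapsTo r Ω (Iio 0) := fun z hz => (hr.neg_iff (subset_closure hz)).2 hz
  have hcont := (hr.contDiffAt hp).continuousAt.continuousWithinAt (s := Ω)
  simpa using hcont.mem_closure hp hmaps

theorem IsDefiningFunction.eq_zero (hr : IsDefiningFunction r Ω) (hp : p ∈ frontier Ω) :
    r p = 0 := by
  refine (hr.nonpos hp.1).antisymm (not_lt.1 fun hneg => hp.2 ?_)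
  rw [hr.isOpen.interior_eq]
  exact (hr.neg_iff hp.1).1 hneg

theorem IsDefiningFunction.fderiv_ne_zero (hr : IsDefiningFunction r Ω) (hp : p ∈ frontier Ω) :
    fderiv ℝ r p ≠ 0 := by
  obtain ⟨U, -, -, -, -, hne⟩ := hr
  exact hne p hp

end DefiningFunction

section InwardSlope

variable {η : ℝ → ℝ} {r : ℂ × ℂ → ℝ} {a : ℝ} {w : ℂ}

theorem fderiv_inl_nonpos_of_mem_closedBall (hr : IsDefiningFunction r (worm η))
    (hη : η (2 * w.re) = 0) {v : ℂ} (hv : v ∈ closedBall (wormCenter w) 1) :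
    fderiv ℝ r (0, Complex.exp w) (v, 0) ≤ 0 := by
  have hfront := zero_mk_exp_mem_frontier_worm hη
  have hmax : IsLocalMaxOn r (closure (worm η)) (0, Complex.exp w) :=
    eventually_mem_nhdsWithin.mono fun z hz => (hr.eq_zero hfront).symm ▸ hr.nonpos hz
  have hsegment : segment ℝ (0, Complex.exp w) ((0, Complex.exp w) + (v, 0)) ⊆
      closure (worm η) := by
    have hball : segment ℝ 0 v ⊆ closedBall (wormCenter w) 1 :=
      (convex_closedBall _ _).segment_subset (by simp [norm_wormCenter]) hv
    rw [Prod.mk_add_mk, zero_add, add_zero, ← Prod.image_mk_segment_left]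
    rintro - ⟨v', hv', rfl⟩
    exact mk_exp_mem_closure_worm hη (hball hv')
  exact hmax.hasFDerivWithinAt_nonpos
    ((hr.contDiffAt hfront.1).differentiableAt (by simp)).hasFDerivAt.hasFDerivWithinAt
    (mem_posTangentConeAt_of_segment_subset hsegment)

theorem fderiv_inr_eq_zero (hr : IsDefiningFunction r (worm η)) (ha : 0 < a)
    (hη : ∀ x, |x| ≤ a → η (2 * x) = 0) (hw : |w.re| ≤ a) (v : ℂ) :
    fderiv ℝ r (0, Complex.exp w) (0, v) = 0 := by
  set S : Set ℂ := Complex.re ⁻¹' Icc (-a) a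
  have hfront {z : ℂ} (hz : z ∈ S) : (0, Complex.exp z) ∈ frontier (worm η) :=
    zero_mk_exp_mem_frontier_worm (hη _ (abs_le.2 hz))
  have hwS : w ∈ S := abs_le.1 hw
  have hunique : UniqueDiffOn ℝ S := by
    refine uniqueDiffOn_convex ((convex_Icc (-a) a).linear_preimage Complex.reLm) ⟨0, ?_⟩
    rw [Complex.interior_preimage_re, interior_Icc]
    simpa using ha
  set D := fderiv ℝ r (0, Complex.exp w)
  have hexp : HasFDerivAt (fun z => ((0 : ℂ), Complex.exp z))
      (ContinuousLinearMap.prod 0 (Complex.exp w • (1 : ℂ →L[ℝ] ℂ))) w :=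
    (hasFDerivAt_const (0 : ℂ) w).prodMk (Complex.hasDerivAt_exp w).complexToReal_fderiv
  have hr' : HasFDerivAt r D (0, Complex.exp w) :=
    ((hr.contDiffAt (hfront hwS).1).differentiableAt (by simp)).hasFDerivAt
  have hcomp := (hr'.comp w hexp).hasFDerivWithinAt (s := S)
  have hzero : HasFDerivWithinAt (fun z => r (0, Complex.exp z)) 0 S w :=
    (hasFDerivWithinAt_const (𝕜 := ℝ) (0 : ℝ) w S).congr (fun z hz => hr.eq_zero (hfront hz))
      (hr.eq_zero (hfront hwS))
  have heq := DFunLike.congr_fun (hunique.eq hwS hcomp hzero) (v / Complex.exp w)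
  simpa [mul_div_cancel₀ _ (Complex.exp_ne_zero w)] using heq

theorem fderiv_wormCenter_neg (hr : IsDefiningFunction r (worm η)) (ha : 0 < a)
    (hη : ∀ x, |x| ≤ a → η (2 * x) = 0) (hw : |w.re| ≤ a) :
    fderiv ℝ r (0, Complex.exp w) (wormCenter w, 0) < 0 := by
  have hηw : η (2 * w.re) = 0 := hη _ hw
  set D := fderiv ℝ r (0, Complex.exp w)
  have hnonpos {v : ℂ} (hv : v ∈ closedBall (wormCenter w) 1) : D (v, 0) ≤ 0 :=
    fderiv_inl_nonpos_of_mem_closedBall hr hηw hv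
  -- If equality held, `v ↦ D (v, 0)` would have an interior maximum and hence vanish.
  refine (hnonpos (mem_closedBall_self zero_le_one)).lt_of_ne fun hzero => ?_
  have hinl : D.comp (.inl ℝ ℂ ℂ) = 0 := by
    refine IsLocalMax.hasFDerivAt_eq_zero (a := wormCenter w) ?_
      (ContinuousLinearMap.hasFDerivAt _)
    filter_upwards [closedBall_mem_nhds _ zero_lt_one] with v hv
    simpa [hzero] using hnonpos hv
  have hinr : D.comp (.inr ℝ ℂ ℂ) = 0 :=
    ContinuousLinearMap.ext fun v => fderiv_inr_eq_zero hr ha hη hw v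
  exact hr.fderiv_ne_zero (zero_mk_exp_mem_frontier_worm hηw)
    (ContinuousLinearMap.prod_ext (hinl.trans (ContinuousLinearMap.zero_comp _).symm)
      (hinr.trans (ContinuousLinearMap.zero_comp _).symm))

/-- The derivative of `-r` at the boundary point `(0, e^w)` of the worm in the direction of
`wormCenter w`, which points into the worm. -/
noncomputable def inwardSlope (r : ℂ × ℂ → ℝ) (w : ℂ) : ℝ :=
  -fderiv ℝ r (0, Complex.exp w) (wormCenter w, 0)

theorem inwardSlope_periodic (r : ℂ × ℂ → ℝ) :
    Function.Periodic (inwardSlope r) ((2 * Real.pi : ℝ) * I) := by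
  intro w
  have hexp : Complex.exp (w + (2 * Real.pi : ℝ) * I) = Complex.exp w := by
    push_cast
    exact Complex.exp_periodic w
  simp only [inwardSlope, wormCenter_add_ofReal_mul_I, hexp]

theorem inwardSlope_pos (hr : IsDefiningFunction r (worm η)) (ha : 0 < a)
    (hη : ∀ x, |x| ≤ a → η (2 * x) = 0) (hw : |w.re| ≤ a) : 0 < inwardSlope r w :=
  neg_pos.2 (fderiv_wormCenter_neg hr ha hη hw)

theorem continuousAt_inwardSlope (hr : IsDefiningFunction r (worm η)) (hη : η (2 * w.re) = 0) :
    ContinuousAt (inwardSlope r) w := by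
  have hfderiv : ContinuousAt (fderiv ℝ r) (0, Complex.exp w) :=
    (hr.contDiffAt (zero_mk_exp_mem_frontier_worm hη).1).continuousAt_fderiv (by simp)
  have hbase : ContinuousAt (fun w => ((0 : ℂ), Complex.exp w)) w := by fun_prop
  have hcenter := continuous_wormCenter.continuousAt (x := w)
  exact ((ContinuousAt.comp (f := fun w => ((0 : ℂ), Complex.exp w)) hfderiv hbase).clm_apply
    (hcenter.prodMk continuousAt_const)).neg

end InwardSlope

section WormCurve

variable {η : ℝ → ℝ} {r : ℂ × ℂ → ℝ} {a : ℝ} {w : ℂ}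

/-- The holomorphic curve `w ↦ (ε e^{2iw}, e^w)`, along which plurisubharmonic functions on the worm
are pulled back. -/
noncomputable def wormCurve (ε : ℝ) (w : ℂ) : ℂ × ℂ :=
  (ε * Complex.exp (2 * I * w), Complex.exp w)

theorem exp_two_mul_I_mul (w : ℂ) :
    Complex.exp (2 * I * w) = Real.exp (-2 * w.im) • wormCenter w := by
  rw [wormCenter, Complex.real_smul, Complex.ofReal_exp, ← Complex.exp_add]
  congr 1
  apply Complex.ext <;> simp

theorem contDiff_wormCurve (ε : ℝ) {n : WithTop ℕ∞} : ContDiff ℂ n (wormCurve ε) := by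
  unfold wormCurve
  fun_prop

theorem wormCurve_mem_worm (hη : η (2 * w.re) = 0) {ε : ℝ} (hε : 0 < ε)
    (hε_lt : ε * Real.exp (-2 * w.im) < 2) : wormCurve ε w ∈ worm η := by
  refine (mk_exp_mem_worm_iff hη).2 ?_
  have hsub : ε * Complex.exp (2 * I * w) - wormCenter w =
      (ε * Real.exp (-2 * w.im) - 1) • wormCenter w := by
    rw [exp_two_mul_I_mul, sub_smul, one_smul, mul_smul, Complex.real_smul (x := ε)]
  rw [mem_ball_iff_norm, hsub, norm_smul, norm_wormCenter, mul_one, Real.norm_eq_abs, abs_lt]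
  have : 0 < ε * Real.exp (-2 * w.im) := by positivity
  constructor <;> linarith

theorem eventually_wormCurve_mem_worm (hη : ∀ x, |x| ≤ a → η (2 * x) = 0) (hw : |w.re| < a) :
    ∀ᶠ p : ℝ × ℂ in 𝓝[>] 0 ×ˢ 𝓝 w, wormCurve p.1 p.2 ∈ worm η := by
  have hcont : Continuous fun p : ℝ × ℂ => p.1 * Real.exp (-2 * p.2.im) := by fun_prop
  have hsmall : ∀ᶠ p : ℝ × ℂ in 𝓝[>] 0 ×ˢ 𝓝 w, p.1 * Real.exp (-2 * p.2.im) < 2 := by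
    have hle : 𝓝[>] (0 : ℝ) ×ˢ 𝓝 w ≤ 𝓝 (0, w) := by
      rw [nhds_prod_eq]
      exact prod_mono_left _ nhdsWithin_le_nhds
    exact ((hcont.tendsto (0, w)).mono_left hle).eventually (gt_mem_nhds (by simp))
  have hstrip : ∀ᶠ z : ℂ in 𝓝 w, |z.re| < a := (isOpen_abs_re_lt a).mem_nhds hw
  filter_upwards [hsmall, tendsto_fst.eventually (eventually_mem_nhdsWithin),
    tendsto_snd.eventually hstrip] with p hp hpos hre
  exact wormCurve_mem_worm (hη _ hre.le) hpos hp

theorem tendsto_inv_mul_neg_wormCurve (hr : IsDefiningFunction r (worm η))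
    (hη : ∀ x, |x| ≤ a → η (2 * x) = 0) (hw : |w.re| < a) :
    Tendsto (fun p : ℝ × ℂ => p.1⁻¹ * -r (wormCurve p.1 p.2)) (𝓝[>] 0 ×ˢ 𝓝 w)
      (𝓝 (Real.exp (-2 * w.im) * inwardSlope r w)) := by
  have hstrict : HasStrictFDerivAt r (fderiv ℝ r (0, Complex.exp w)) (0, Complex.exp w) :=
    (hr.contDiffAt (zero_mk_exp_mem_frontier_worm (hη _ hw.le)).1).hasStrictFDerivAt (by simp)
  have hbase : Tendsto (fun p : ℝ × ℂ => ((0 : ℂ), Complex.exp p.2)) (𝓝[>] 0 ×ˢ 𝓝 w)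
      (𝓝 (0, Complex.exp w)) :=
    ((by fun_prop : Continuous fun z : ℂ => ((0 : ℂ), Complex.exp z)).tendsto w).comp tendsto_snd
  have hdir : Tendsto (fun p : ℝ × ℂ => (Complex.exp (2 * I * p.2), (0 : ℂ))) (𝓝[>] 0 ×ˢ 𝓝 w)
      (𝓝 (Complex.exp (2 * I * w), 0)) :=
    ((by fun_prop : Continuous fun z : ℂ => (Complex.exp (2 * I * z), (0 : ℂ))).tendsto w).comp
      tendsto_snd
  have hε : Tendsto (Prod.fst : ℝ × ℂ → ℝ) (𝓝[>] 0 ×ˢ 𝓝 w) (𝓝[≠] 0) :=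
    tendsto_fst.mono_right (nhdsWithin_mono _ fun _ h => ne_of_gt h)
  have hlim := (tendsto_inv_smul_sub_of_hasStrictFDerivAt hstrict hbase hdir hε).neg
  have hvalue : -fderiv ℝ r (0, Complex.exp w) (Complex.exp (2 * I * w), 0) =
      Real.exp (-2 * w.im) * inwardSlope r w := by
    have hsmul : (Complex.exp (2 * I * w), (0 : ℂ)) = Real.exp (-2 * w.im) • (wormCenter w, 0) := by
      rw [exp_two_mul_I_mul, Prod.smul_mk, smul_zero]
    rw [hsmul, map_smul, smul_eq_mul, inwardSlope, mul_neg]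
  rw [hvalue] at hlim
  refine hlim.congr' ?_
  have hstrip : ∀ᶠ z : ℂ in 𝓝 w, |z.re| < a := (isOpen_abs_re_lt a).mem_nhds hw
  filter_upwards [tendsto_snd.eventually hstrip] with p hp
  have hzero : r (0, Complex.exp p.2) = 0 := hr.eq_zero (zero_mk_exp_mem_frontier_worm (hη _ hp.le))
  simp [hzero, wormCurve]

end WormCurve

section Superharmonic

variable {η : ℝ → ℝ} {r : ℂ × ℂ → ℝ} {a δ : ℝ} {w : ℂ}

theorem IsDefiningFunction.contDiffAt_neg_rpow {Ω : Set (ℂ × ℂ)} {p : ℂ × ℂ}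
    (hr : IsDefiningFunction r Ω) (hp : p ∈ Ω) (δ : ℝ) :
    ContDiffAt ℝ ∞ (fun z => -(-r z) ^ δ) p :=
  have hneg : r p < 0 := (hr.neg_iff (subset_closure hp)).2 hp
  ((hr.contDiffAt (subset_closure hp)).neg.rpow_const_of_ne (neg_pos.2 hneg).ne').neg

/-- The pullback of `(-r) ^ δ` along `wormCurve ε`, divided by `ε ^ δ` so that it has a finite limit
as `ε` decreases to `0`. -/
noncomputable def rescaledPullback (r : ℂ × ℂ → ℝ) (δ ε : ℝ) : ℂ → ℝ :=
  -ε ^ (-δ) • ((fun z => -(-r z) ^ δ) ∘ wormCurve ε)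

theorem contDiffAt_rescaledPullback (hr : IsDefiningFunction r (worm η)) {ε : ℝ}
    (hmem : wormCurve ε w ∈ worm η) : ContDiffAt ℝ 2 (rescaledPullback r δ ε) w :=
  (((hr.contDiffAt_neg_rpow hmem δ).of_le ENat.LEInfty.out).comp w
    ((contDiff_wormCurve ε).contDiffAt.restrict_scalars ℝ)).const_smul (-ε ^ (-δ))

theorem laplacian_rescaledPullback_nonpos (hr : IsDefiningFunction r (worm η))
    (hpsh : ∀ p ∈ worm η, ∀ v, 0 ≤ leviForm (fun z => -(-r z) ^ δ) p v) {ε : ℝ} (hε : 0 ≤ ε)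
    (hmem : wormCurve ε w ∈ worm η) : Δ (rescaledPullback r δ ε) w ≤ 0 := by
  have hu : ContDiffAt ℝ 2 (fun z => -(-r z) ^ δ) (wormCurve ε w) :=
    (hr.contDiffAt_neg_rpow hmem δ).of_le ENat.LEInfty.out
  have hγ := contDiff_wormCurve ε (n := 2)
  rw [rescaledPullback, InnerProductSpace.laplacian_smul _
    (hu.comp w (hγ.contDiffAt.restrict_scalars ℝ)), laplacian_comp_eq_leviForm hu hγ.contDiffAt,
    smul_eq_mul, neg_mul]
  exact neg_nonpos.2 <| mul_nonneg (Real.rpow_nonneg hε _) <|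
    mul_nonneg zero_le_four (hpsh _ hmem _)

/-- The limit of `rescaledPullback r δ ε` on the strip as `ε` decreases to `0`. -/
noncomputable def blowupLimit (r : ℂ × ℂ → ℝ) (δ : ℝ) (w : ℂ) : ℝ :=
  Real.exp (-2 * δ * w.im) * inwardSlope r w ^ δ

theorem tendsto_rescaledPullback (hr : IsDefiningFunction r (worm η))
    (hη : ∀ x, |x| ≤ a → η (2 * x) = 0) (hw : |w.re| < a) :
    Tendsto (fun p : ℝ × ℂ => rescaledPullback r δ p.1 p.2) (𝓝[>] 0 ×ˢ 𝓝 w)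
      (𝓝 (blowupLimit r δ w)) := by
  have hslope := inwardSlope_pos hr ((abs_nonneg _).trans_lt hw) hη hw.le
  have hvalue : (Real.exp (-2 * w.im) * inwardSlope r w) ^ δ = blowupLimit r δ w := by
    rw [blowupLimit, Real.mul_rpow (Real.exp_pos _).le hslope.le, ← Real.exp_mul,
      mul_right_comm (-2) w.im δ]
  rw [← hvalue]
  refine ((tendsto_inv_mul_neg_wormCurve hr hη hw).rpow_const (.inl (by positivity))).congr' ?_
  filter_upwards [eventually_wormCurve_mem_worm hη hw,
    tendsto_fst.eventually eventually_mem_nhdsWithin] with p hmem hε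
  have hneg : r (wormCurve p.1 p.2) < 0 := (hr.neg_iff (subset_closure hmem)).2 hmem
  have hε' : 0 ≤ p.1 := le_of_lt hε
  rw [Real.mul_rpow (inv_nonneg.2 hε') (neg_pos.2 hneg).le, Real.inv_rpow hε',
    ← Real.rpow_neg hε']
  simp [rescaledPullback]

theorem continuousAt_inwardSlope_rpow (hr : IsDefiningFunction r (worm η)) (ha : 0 < a)
    (hη : ∀ x, |x| ≤ a → η (2 * x) = 0) (hw : |w.re| ≤ a) (δ : ℝ) :
    ContinuousAt (fun z => inwardSlope r z ^ δ) w :=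
  (continuousAt_inwardSlope hr (hη _ hw)).rpow_const (.inl (inwardSlope_pos hr ha hη hw).ne')

theorem tendstoLocallyUniformlyOn_rescaledPullback (hr : IsDefiningFunction r (worm η))
    (hη : ∀ x, |x| ≤ a → η (2 * x) = 0) :
    TendstoLocallyUniformlyOn (rescaledPullback r δ) (blowupLimit r δ) (𝓝[>] 0)
      {w | |w.re| < a} := by
  refine tendstoLocallyUniformlyOn_of_tendsto_prod (fun w hw => ?_) fun w hw =>
    (tendsto_rescaledPullback hr hη hw).mono_left (prod_mono_right _ nhdsWithin_le_nhds)
  have hexp : ContinuousAt (fun z : ℂ => Real.exp (-2 * δ * z.im)) w := by fun_prop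
  have ha : 0 < a := (abs_nonneg _).trans_lt hw
  exact (hexp.mul (continuousAt_inwardSlope_rpow hr ha hη (le_of_lt hw) δ)).continuousWithinAt

theorem not_isLocalMin_blowupLimit_sub (hr : IsDefiningFunction r (worm η))
    (hpsh : ∀ p ∈ worm η, ∀ v, 0 ≤ leviForm (fun z => -(-r z) ^ δ) p v)
    (hη : ∀ x, |x| ≤ a → η (2 * x) = 0) (hw : |w.re| < a) {φ : ℂ → ℝ} (hφ : ContDiffAt ℝ 2 φ w)
    (hpos : 0 < Δ φ w) : ¬ IsLocalMin (blowupLimit r δ - φ) w := by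
  refine not_isLocalMin_sub_of_laplacian_nonpos (isOpen_abs_re_lt a) hw
    (tendstoLocallyUniformlyOn_rescaledPullback hr hη) ?_ hφ hpos
  filter_upwards [eventually_wormCurve_mem_worm hη hw,
    tendsto_fst.eventually eventually_mem_nhdsWithin] with p hmem hε
  exact ⟨contDiffAt_rescaledPullback hr hmem,
    laplacian_rescaledPullback_nonpos hr hpsh (le_of_lt hε) hmem⟩

theorem exists_isLocalMin_blowupLimit_sub_expCos (hr : IsDefiningFunction r (worm η)) (ha : 0 < a)
    (hη : ∀ x, |x| ≤ a → η (2 * x) = 0) (δ : ℝ) :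
    ∃ q ∈ Ioo 0 (Real.pi / (2 * a)), ∃ c : ℝ, ∃ w₁, |w₁.re| < a ∧
      0 < c * expCos (-2 * δ) q w₁ ∧
      IsLocalMin (blowupLimit r δ - c • expCos (-2 * δ) q) w₁ := by
  obtain ⟨q, hq, c, w₁, hw₁, htouch, hbelow⟩ := exists_cos_le_eq_of_periodic
    (h := fun w => inwardSlope r w ^ δ) ha Real.two_pi_pos
    (fun w hw => (continuousAt_inwardSlope_rpow hr ha hη hw δ).continuousWithinAt)
    (fun w => by simp only [inwardSlope_periodic r w])
    fun w hw => Real.rpow_pos_of_pos (inwardSlope_pos hr ha hη hw) δ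
  have hfactor (w : ℂ) : c * expCos (-2 * δ) q w =
      Real.exp (-2 * δ * w.im) * (c * Real.cos (q * w.re)) := by
    rw [expCos]
    ring
  refine ⟨q, hq, c, w₁, hw₁, ?_, ?_⟩
  · rw [hfactor, htouch]
    have hslope := inwardSlope_pos hr ha hη hw₁.le
    positivity
  · filter_upwards [(isOpen_abs_re_lt a).mem_nhds hw₁] with w hw
    simp only [Pi.sub_apply, Pi.smul_apply, smul_eq_mul, hfactor, blowupLimit, htouch, sub_self,
      sub_nonneg]
    exact mul_le_mul_of_nonneg_left (hbelow w (le_of_lt hw)) (Real.exp_pos _).le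

end Superharmonic

theorem StrictlyPlurisubharmonicOn.leviForm_nonneg {u : ℂ × ℂ → ℝ} {Ω : Set (ℂ × ℂ)}
    (hu : StrictlyPlurisubharmonicOn u Ω) {p : ℂ × ℂ} (hp : p ∈ Ω) (v : ℂ × ℂ) :
    0 ≤ leviForm u p v := by
  obtain rfl | hv := eq_or_ne v 0
  · simp [leviForm, iteratedFDeriv_two_apply]
  · exact (hu.2 p hp v hv).le

theorem IsWormProfile.eq_zero {μ : ℝ} {η : ℝ → ℝ} (hη : IsWormProfile μ η) {x : ℝ}
    (hx : |x| ≤ μ) : η x = 0 := by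
  have hmem : x ∈ η ⁻¹' {0} := hη.zero_set ▸ abs_le.1 hx
  exact hmem

theorem mainTheorem2_general {μ : ℝ} (hμ : 0 < μ) {η : ℝ → ℝ} (hη : ∀ x, |x| ≤ μ → η x = 0)
    {r : ℂ × ℂ → ℝ} (hr : IsDefiningFunction r (worm η)) {δ : ℝ}
    (hpsh : ∀ p ∈ worm η, ∀ v, 0 ≤ leviForm (fun z => -(-r z) ^ δ) p v) :
    δ < Real.pi / (2 * μ) := by
  by_contra! hle
  have hη' (x : ℝ) (hx : |x| ≤ μ / 2) : η (2 * x) = 0 :=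
    hη _ (by rw [abs_mul, abs_two]; linarith)
  obtain ⟨q, ⟨hq₀, hq⟩, c, w₁, hw₁, hpos, hmin⟩ :=
    exists_isLocalMin_blowupLimit_sub_expCos hr (half_pos hμ) hη' δ
  have hqδ : q < 2 * δ :=
    calc q < Real.pi / (2 * (μ / 2)) := hq
      _ = 2 * (Real.pi / (2 * μ)) := by ring
      _ ≤ 2 * δ := by linarith
  have hΔ : 0 < Δ (c • expCos (-2 * δ) q) w₁ := by
    rw [InnerProductSpace.laplacian_smul c (contDiff_expCos _ _).contDiffAt, laplacian_expCos,
      smul_eq_mul, mul_left_comm]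
    exact mul_pos (by nlinarith) hpos
  exact not_isLocalMin_blowupLimit_sub hr hpsh hη' hw₁
    ((contDiff_expCos _ _).contDiffAt.const_smul c) hΔ hmin

theorem mainTheorem2 :
    (∀ δ₀ : ℝ, 0 < δ₀ → ∃ μ₀ : ℝ, 0 < μ₀ ∧
      ∀ μ : ℝ, μ₀ ≤ μ → ∀ η : ℝ → ℝ, IsWormProfile μ η →
        ∀ (r : ℂ × ℂ → ℝ) (δ : ℝ), IsDefiningFunction r (worm η) → 0 < δ →
          IsBoundedPshExhaustion (fun z => -(-r z) ^ δ) (worm η) → δ < δ₀) ∧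
    (∀ μ : ℝ, 0 < μ → ∀ η : ℝ → ℝ, IsWormProfile μ η →
      ∀ (r : ℂ × ℂ → ℝ) (δ : ℝ), IsDefiningFunction r (worm η) → 0 < δ →
        IsBoundedPshExhaustion (fun z => -(-r z) ^ δ) (worm η) →
          δ < Real.pi / (2 * μ)) := by
  have hbound {μ : ℝ} (hμ : 0 < μ) {η : ℝ → ℝ} (hη : IsWormProfile μ η) {r : ℂ × ℂ → ℝ} {δ : ℝ}
      (hr : IsDefiningFunction r (worm η))
      (hu : IsBoundedPshExhaustion (fun z => -(-r z) ^ δ) (worm η)) : δ < Real.pi / (2 * μ) :=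
    mainTheorem2_general hμ (fun _ => hη.eq_zero) hr fun _ => hu.strictlyPsh.leviForm_nonneg
  refine ⟨fun δ₀ hδ₀ => ⟨Real.pi / (2 * δ₀), by positivity, fun μ hμ η hη r δ hr _ hu => ?_⟩,
    fun μ hμ η hη r δ hr _ hu => hbound hμ hη hr hu⟩
  have hμ₀ : 0 < μ := lt_of_lt_of_le (by positivity) hμ
  refine (hbound hμ₀ hη hr hu).trans_le ?_
  rw [div_le_iff₀ (by positivity)] at hμ ⊢
  linarith
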